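/- Let $n\ge 0$, $T=(\mathbb{C}^*)^n$, let $\Xi$ be a nonsingular fan in $\mathbb{R}^n$ (a nonempty, possibly infinite, collection of cones, each generated by part of a $\mathbb{Z}$-basis of $\mathbb{Z}^n$, containing all faces of its members, any two members meeting in a common face), and let $X=X_\Xi$ be the associated nonsingular toric variety, regarded as a complex manifold with its holomorphic left $T$-action. Let $G$ be a discrete group, regarded as a complex Lie group of dimension $0$. Let $\pi:\mathcal{E}\to X$ be a holomorphic $T$-equivariant principal $G$-bundle. That is: $\mathcal{E}$ is a complex manifold with a holomorphic left $T$-action and a holomorphic right $G$-action; $\pi$ is holomorphic, $\pi(te)=t\,\pi(e)$, $\pi(e\cdot g)=\pi(e)$ and $t(e\cdot g)=(te)\cdot g$ for all $t\in T$, $g\in G$, $e\in\mathcal{E}$; and every point of $X$ has an open neighbourhood $U$ with a $G$-equivariant biholomorphism $\pi^{-1}(U)\cong U\times G$ over $U$, where $G$ acts on $U\times G$ by $(x,h)\cdot g=(x,hg)$. Then $\mathcal{E}$ is trivial with trivial $T$-action: there is a $G$-equivariant biholomorphism $\Phi:\mathcal{E}\to X\times G$ over $X$, and under every such $\Phi$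 the action of $T$ on $\mathcal{E}$ corresponds to the action $t(x,h)=(tx,h)$ on $X\times G$. -/

import Mathlib

open scoped Manifold ContDiff

noncomputable section

/-! ### The algebraic torus -/

/-- The algebraic torus `T = (ℂ^*)^n`. -/
def Torus (n : ℕ) : Type := Fin n → ℂˣ

namespace Torus

variable {n : ℕ}

instance : CommGroup (Torus n) := inferInstanceAs (CommGroup (Fin n → ℂˣ))

instance : TopologicalSpace (Torus n) := inferInstanceAs (TopologicalSpace (Fin n → ℂˣ))

/-- The inclusion `(ℂ^*)^n ⊆ ℂ^n`. -/
def coords (t : Torus n) : Fin n → ℂ := fun i => (t i : ℂ)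

theorem isOpenEmbedding_coords :
    Topology.IsOpenEmbedding (coords : Torus n → (Fin n → ℂ)) :=
  Topology.IsOpenEmbedding.piMap (fun _ : Fin n => Units.isOpenEmbedding_val (R := ℂ))

/-- The complex structure of `T` is the one of an open subset of `ℂ^n`. -/
instance : ChartedSpace (Fin n → ℂ) (Torus n) :=
  isOpenEmbedding_coords.singletonChartedSpace

instance : IsManifold 𝓘(ℂ, Fin n → ℂ) ω (Torus n) :=
  isOpenEmbedding_coords.isManifold_singleton

/-- The character `χ^m : T → ℂ^*` of a lattice point `m` of `M = ℤ^n`. -/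
def character (m : Fin n → ℤ) (t : Torus n) : ℂ := ∏ i, (t i : ℂ) ^ m i

theorem character_ne_zero (m : Fin n → ℤ) (t : Torus n) : character m t ≠ 0 :=
  Finset.prod_ne_zero_iff.2 fun i _ => zpow_ne_zero _ (t i).ne_zero

theorem character_zero (t : Torus n) : character 0 t = 1 := by simp [character]

theorem character_add (m m' : Fin n → ℤ) (t : Torus n) :
    character (m + m') t = character m t * character m' t := by
  simp only [character, Pi.add_apply, ← Finset.prod_mul_distrib]
  exact Finset.prod_congr rfl fun i _ => zpow_add₀ (t i).ne_zero _ _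

theorem character_one (m : Fin n → ℤ) : character m (1 : Torus n) = 1 :=
  Finset.prod_eq_one fun i _ => by
    have : ((1 : Torus n) i) = 1 := rfl
    simp [this]

theorem character_mul (m : Fin n → ℤ) (s t : Torus n) :
    character m (s * t) = character m s * character m t := by
  simp only [character, ← Finset.prod_mul_distrib]
  refine Finset.prod_congr rfl fun i _ => ?_
  have : (s * t) i = s i * t i := rfl
  rw [this, Units.val_mul, mul_zpow]

end Torus

/-! ### Lattice cones in `N_ℝ = ℝ^n`, with `N = ℤ^n`, `M = ℤ^n` and the standard pairing -/

/-- The pairing of a point of `M = ℤ^n` with a vector of `N_ℝ = ℝ^n`. -/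
def latticePairing {n : ℕ} (m : Fin n → ℤ) (v : Fin n → ℝ) : ℝ := ∑ k, (m k : ℝ) * v k

/-- A lattice point of `N = ℤ^n` as a vector of `N_ℝ = ℝ^n`. -/
def latticeVec {n : ℕ} (w : Fin n → ℤ) : Fin n → ℝ := fun k => (w k : ℝ)

/-- The cone generated by the members `b i`, `i ∈ J`, of a `ℤ`-basis `b` of `N = ℤ^n`. -/
def basisCone {n : ℕ} (b : Module.Basis (Fin n) ℤ (Fin n → ℤ)) (J : Set (Fin n)) :
    PointedCone ℝ (Fin n → ℝ) :=
  PointedCone.hull ℝ ((fun i => latticeVec (b i)) '' J)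

/-- `m ∈ τ^⊥ ∩ M`. -/
def PerpTo {n : ℕ} (τ : PointedCone ℝ (Fin n → ℝ)) (m : Fin n → ℤ) : Prop :=
  ∀ v ∈ τ, latticePairing m v = 0

/-- The members of the basis of `M = ℤ^n` dual to a `ℤ`-basis `b` of `N = ℤ^n`. -/
def dualVec {n : ℕ} (b : Module.Basis (Fin n) ℤ (Fin n → ℤ)) (i : Fin n) : Fin n → ℤ :=
  fun k => b.repr (Pi.single k 1) i

/-- A nonsingular fan in `N_ℝ = ℝ^n`: a nonempty collection of cones, each generated by a part of a
`ℤ`-basis of `N = ℤ^n` (in particular rational polyhedral and strongly convex), which contains every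
face of each of its members and in which any two members intersect in a common face. The collection
may be infinite. -/
structure NonsingularFan (n : ℕ) where
  cones : Set (PointedCone ℝ (Fin n → ℝ))
  nonempty : cones.Nonempty
  nonsingular : ∀ σ ∈ cones, ∃ (b : Module.Basis (Fin n) ℤ (Fin n → ℤ)) (J : Set (Fin n)),
    σ = basisCone b J
  face_mem : ∀ σ ∈ cones, ∀ τ : PointedCone ℝ (Fin n → ℝ), τ.IsFaceOf σ → τ ∈ cones
  inter_face : ∀ σ ∈ cones, ∀ τ ∈ cones, (σ ⊓ τ).IsFaceOf σ ∧ (σ ⊓ τ).IsFaceOf τ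

section LatticeLemmas

variable {n : ℕ} (b : Module.Basis (Fin n) ℤ (Fin n → ℤ))

theorem latticePairing_latticeVec (m w : Fin n → ℤ) :
    latticePairing m (latticeVec w) = ((m ⬝ᵥ w : ℤ) : ℝ) := by
  simp [latticePairing, latticeVec, dotProduct]

theorem latticePairing_add_left (m m' : Fin n → ℤ) (v : Fin n → ℝ) :
    latticePairing (m + m') v = latticePairing m v + latticePairing m' v := by
  simp [latticePairing, add_mul, Finset.sum_add_distrib]

theorem latticePairing_neg_left (m : Fin n → ℤ) (v : Fin n → ℝ) :
    latticePairing (-m) v = - latticePairing m v := by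
  simp [latticePairing]

theorem latticePairing_zero_left (v : Fin n → ℝ) : latticePairing 0 v = 0 := by
  simp [latticePairing]

theorem latticePairing_add_right (m : Fin n → ℤ) (v w : Fin n → ℝ) :
    latticePairing m (v + w) = latticePairing m v + latticePairing m w := by
  simp [latticePairing, mul_add, Finset.sum_add_distrib]

theorem latticePairing_smul_right (m : Fin n → ℤ) (a : ℝ) (v : Fin n → ℝ) :
    latticePairing m (a • v) = a * latticePairing m v := by
  simp only [latticePairing, Pi.smul_apply, smul_eq_mul, Finset.mul_sum]
  exact Finset.sum_congr rfl fun k _ => by ring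

theorem dualVec_dotProduct (i : Fin n) (w : Fin n → ℤ) : dualVec b i ⬝ᵥ w = b.repr w i := by
  have h : w = ∑ k, w k • (Pi.single k 1 : Fin n → ℤ) := by
    simpa using pi_eq_sum_univ' w
  conv_rhs => rw [h]
  rw [map_sum, Finsupp.finsetSum_apply]
  refine Finset.sum_congr rfl fun k _ => ?_
  rw [map_smul, Finsupp.smul_apply, smul_eq_mul, mul_comm]
  rfl

theorem dualVec_dotProduct_basis (i j : Fin n) :
    dualVec b i ⬝ᵥ b j = if i = j then 1 else 0 := by
  rw [dualVec_dotProduct, Module.Basis.repr_self, Finsupp.single_apply]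
  simp [eq_comm]

theorem sum_dualVec_mul (k l : Fin n) :
    ∑ i, dualVec b i k * b i l = if k = l then 1 else 0 := by
  have h := congrFun (b.sum_repr (Pi.single k 1)) l
  simp only [Finset.sum_apply, Pi.smul_apply, smul_eq_mul, Pi.single_apply] at h
  rw [show (if k = l then (1 : ℤ) else 0) = if l = k then 1 else 0 by simp [eq_comm], ← h]
  rfl

theorem eq_sum_dualVec (m : Fin n → ℤ) : m = ∑ i, (m ⬝ᵥ b i) • dualVec b i := by
  ext k
  simp only [Finset.sum_apply, Pi.smul_apply, smul_eq_mul, dotProduct, Finset.sum_mul]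
  rw [Finset.sum_comm]
  have : ∀ l, ∑ i, m l * b i l * dualVec b i k = m l * if k = l then 1 else 0 := by
    intro l
    rw [← sum_dualVec_mul b k l, Finset.mul_sum]
    exact Finset.sum_congr rfl fun i _ => by ring
  simp [this]

theorem eq_sum_latticeVec (v : Fin n → ℝ) :
    v = ∑ i, latticePairing (dualVec b i) v • latticeVec (b i) := by
  ext l
  simp only [Finset.sum_apply, Pi.smul_apply, smul_eq_mul, latticePairing, latticeVec,
    Finset.sum_mul]
  rw [Finset.sum_comm]
  have : ∀ k, ∑ i, (dualVec b i k : ℝ) * v k * (b i l : ℝ) = v k * if k = l then 1 else 0 := by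
    intro k
    have h : ((∑ i, dualVec b i k * b i l : ℤ) : ℝ) = if k = l then 1 else 0 := by
      rw [sum_dualVec_mul]; split_ifs <;> simp
    rw [← h, Int.cast_sum, Finset.mul_sum]
    exact Finset.sum_congr rfl fun i _ => by push_cast; ring
  simp [this]

theorem latticePairing_dualVec_latticeVec (i j : Fin n) :
    latticePairing (dualVec b i) (latticeVec (b j)) = if i = j then 1 else 0 := by
  rw [latticePairing_latticeVec, dualVec_dotProduct_basis]
  split_ifs <;> simp

theorem latticeVec_mem_basisCone {J : Set (Fin n)} {i : Fin n} (hi : i ∈ J) :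
    latticeVec (b i) ∈ basisCone b J :=
  PointedCone.subset_hull ⟨i, hi, rfl⟩

theorem mem_basisCone_iff (J : Set (Fin n)) (v : Fin n → ℝ) :
    v ∈ basisCone b J ↔
      ∀ i, 0 ≤ latticePairing (dualVec b i) v ∧ (i ∉ J → latticePairing (dualVec b i) v = 0) := by
  constructor
  · intro hv
    refine Submodule.span_induction ?_ ?_ ?_ ?_ hv
    · rintro _ ⟨j, hj, rfl⟩ i
      simp only [latticePairing_dualVec_latticeVec]
      refine ⟨by split_ifs <;> norm_num, fun hi => if_neg ?_⟩
      rintro rfl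
      exact hi hj
    · intro i
      simp [latticePairing]
    · intro x y _ _ hx hy i
      rw [latticePairing_add_right]
      exact ⟨add_nonneg (hx i).1 (hy i).1, fun hi => by rw [(hx i).2 hi, (hy i).2 hi, add_zero]⟩
    · intro a x _ hx i
      change 0 ≤ latticePairing _ ((a : ℝ) • x) ∧ (_ → latticePairing _ ((a : ℝ) • x) = 0)
      rw [latticePairing_smul_right]
      exact ⟨mul_nonneg a.2 (hx i).1, fun hi => by rw [(hx i).2 hi, mul_zero]⟩
  · intro h
    rw [eq_sum_latticeVec b v]
    refine Submodule.sum_mem _ fun i _ => ?_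
    by_cases hi : i ∈ J
    · exact PointedCone.smul_mem _ (h i).1 (latticeVec_mem_basisCone b hi)
    · rw [(h i).2 hi, zero_smul]
      exact Submodule.zero_mem _

theorem latticeVec_mem_basisCone_iff (J : Set (Fin n)) (i : Fin n) :
    latticeVec (b i) ∈ basisCone b J ↔ i ∈ J := by
  refine ⟨fun h => ?_, latticeVec_mem_basisCone b⟩
  by_contra hi
  have := ((mem_basisCone_iff b J _).1 h i).2 hi
  simp [latticePairing_dualVec_latticeVec] at this

theorem basisCone_mono {K J : Set (Fin n)} (h : K ⊆ J) : basisCone b K ≤ basisCone b J :=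
  Submodule.span_mono (Set.image_mono h)

theorem basisCone_isFaceOf {K J : Set (Fin n)} (h : K ⊆ J) :
    (basisCone b K).IsFaceOf (basisCone b J) where
  le := basisCone_mono b h
  mem_of_smul_add_mem := by
    intro x y a hx hy ha hxy
    rw [mem_basisCone_iff] at hx hy hxy ⊢
    refine fun i => ⟨(hx i).1, fun hi => ?_⟩
    have h1 := (hxy i).2 hi
    rw [latticePairing_add_right, latticePairing_smul_right] at h1
    have h2 := mul_nonneg ha.le (hx i).1
    have h3 := (hy i).1
    have h4 : a * latticePairing (dualVec b i) x = 0 := by linarith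
    exact (mul_eq_zero.1 h4).resolve_left ha.ne'

theorem eq_basisCone_of_isFaceOf {τ : PointedCone ℝ (Fin n → ℝ)} {J : Set (Fin n)}
    (h : τ.IsFaceOf (basisCone b J)) :
    τ = basisCone b {j | j ∈ J ∧ latticeVec (b j) ∈ τ} := by
  apply le_antisymm
  · intro v hv
    have hv' := (mem_basisCone_iff b J v).1 (h.le hv)
    rw [mem_basisCone_iff]
    refine fun i => ⟨(hv' i).1, fun hi => ?_⟩
    by_contra hne
    have hiJ : i ∈ J := by
      by_contra hiJ
      exact hne ((hv' i).2 hiJ)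
    refine hi ⟨hiJ, ?_⟩
    have hs := hv
    rw [eq_sum_latticeVec b v, ← Finset.add_sum_erase _ _ (Finset.mem_univ i)] at hs
    refine h.mem_of_smul_add_mem (latticeVec_mem_basisCone b hiJ) ?_
      (lt_of_le_of_ne (hv' i).1 (Ne.symm hne)) hs
    refine Submodule.sum_mem _ fun j _ => ?_
    by_cases hj : j ∈ J
    · exact PointedCone.smul_mem _ (hv' j).1 (latticeVec_mem_basisCone b hj)
    · rw [(hv' j).2 hj, zero_smul]
      exact Submodule.zero_mem _
  · refine Submodule.span_le.2 ?_
    rintro _ ⟨j, hj, rfl⟩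
    exact hj.2

theorem perpTo_basisCone_iff (K : Set (Fin n)) (m : Fin n → ℤ) :
    PerpTo (basisCone b K) m ↔ ∀ i ∈ K, m ⬝ᵥ b i = 0 := by
  constructor
  · intro h i hi
    have := h _ (latticeVec_mem_basisCone b hi)
    rw [latticePairing_latticeVec] at this
    exact_mod_cast this
  · intro h v hv
    refine Submodule.span_induction ?_ ?_ ?_ ?_ hv
    · rintro _ ⟨j, hj, rfl⟩
      simp [latticePairing_latticeVec, h j hj]
    · simp [latticePairing]
    · intro x y _ _ hx hy
      rw [latticePairing_add_right, hx, hy, add_zero]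
    · intro a x _ hx
      change latticePairing _ ((a : ℝ) • x) = 0
      rw [latticePairing_smul_right, hx, mul_zero]

theorem perpTo_dualVec_iff (K : Set (Fin n)) (i : Fin n) :
    PerpTo (basisCone b K) (dualVec b i) ↔ i ∉ K := by
  rw [perpTo_basisCone_iff]
  constructor
  · intro h hi
    have := h i hi
    simp [dualVec_dotProduct_basis] at this
  · intro hi j hj
    rw [dualVec_dotProduct_basis, if_neg]
    rintro rfl
    exact hi hj

theorem PerpTo.zero (τ : PointedCone ℝ (Fin n → ℝ)) : PerpTo τ 0 :=
  fun _ _ => latticePairing_zero_left _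

theorem PerpTo.add {τ : PointedCone ℝ (Fin n → ℝ)} {m m' : Fin n → ℤ} (h : PerpTo τ m)
    (h' : PerpTo τ m') : PerpTo τ (m + m') :=
  fun v hv => by rw [latticePairing_add_left, h v hv, h' v hv, add_zero]

theorem PerpTo.neg {τ : PointedCone ℝ (Fin n → ℝ)} {m : Fin n → ℤ} (h : PerpTo τ m) :
    PerpTo τ (-m) :=
  fun v hv => by rw [latticePairing_neg_left, h v hv, neg_zero]

theorem PerpTo.nsmul {τ : PointedCone ℝ (Fin n → ℝ)} {m : Fin n → ℤ} (h : PerpTo τ m) (k : ℕ) :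
    PerpTo τ (k • m) := by
  induction k with
  | zero => simpa using PerpTo.zero τ
  | succ k ih => rw [succ_nsmul]; exact ih.add h

theorem PerpTo.zsmul {τ : PointedCone ℝ (Fin n → ℝ)} {m : Fin n → ℤ} (h : PerpTo τ m) (k : ℤ) :
    PerpTo τ (k • m) := by
  obtain ⟨j, rfl | rfl⟩ := k.eq_nat_or_neg
  · simpa using h.nsmul j
  · simpa using (h.nsmul j).neg

end LatticeLemmas

/-! ### The toric variety of a nonsingular fan -/

/-- The points of the toric variety `X_Ξ`. It is the disjoint union of its torus orbits `O_τ`,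
`τ ∈ Ξ`, and `O_τ` is the group of homomorphisms `τ^⊥ ∩ M → ℂ^*`. A point of `O_τ` is recorded as the
function on `M` which is the homomorphism on `τ^⊥ ∩ M` and zero elsewhere. Restricted to
`σ^∨ ∩ M` for a cone `σ ∈ Ξ` of which `τ` is a face, this function is the corresponding point
`σ^∨ ∩ M → ℂ` (a homomorphism of monoids) of the affine toric variety `X_σ`. -/
@[ext]
structure ToricVariety {n : ℕ} (Ξ : NonsingularFan n) where
  cone : PointedCone ℝ (Fin n → ℝ)
  cone_mem : cone ∈ Ξ.cones
  val : (Fin n → ℤ) → ℂ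
  val_ne_zero_iff : ∀ m, val m ≠ 0 ↔ PerpTo cone m
  val_zero : val 0 = 1
  val_add : ∀ m m', PerpTo cone m → PerpTo cone m' → val (m + m') = val m * val m'

namespace ToricVariety

variable {n : ℕ} {Ξ : NonsingularFan n}

/-- The torus acts by `(t • x)(m) = χ^m(t) x(m)`. -/
instance : MulAction (Torus n) (ToricVariety Ξ) where
  smul t x :=
    { cone := x.cone
      cone_mem := x.cone_mem
      val := fun m => Torus.character m t * x.val m
      val_ne_zero_iff := fun m => by
        rw [← x.val_ne_zero_iff m, mul_ne_zero_iff]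
        exact and_iff_right (Torus.character_ne_zero m t)
      val_zero := by rw [Torus.character_zero, x.val_zero, one_mul]
      val_add := fun m m' h h' => by
        rw [Torus.character_add, x.val_add m m' h h']
        ring }
  one_smul x := ToricVariety.ext rfl (funext fun m => by
    change Torus.character m 1 * x.val m = x.val m
    rw [Torus.character_one, one_mul])
  mul_smul s t x := ToricVariety.ext rfl (funext fun m => by
    change Torus.character m (s * t) * x.val m
      = Torus.character m s * (Torus.character m t * x.val m)
    rw [Torus.character_mul, mul_assoc])

theorem val_nsmul (x : ToricVariety Ξ) {m : Fin n → ℤ} (h : PerpTo x.cone m) (k : ℕ) :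
    x.val (k • m) = x.val m ^ k := by
  induction k with
  | zero => simp [x.val_zero]
  | succ k ih => rw [succ_nsmul, x.val_add _ _ (h.nsmul k) h, ih, pow_succ]

theorem val_neg (x : ToricVariety Ξ) {m : Fin n → ℤ} (h : PerpTo x.cone m) :
    x.val (-m) = (x.val m)⁻¹ := by
  have := x.val_add m (-m) h h.neg
  rw [add_neg_cancel, x.val_zero] at this
  exact eq_inv_of_mul_eq_one_right this.symm

theorem val_zsmul (x : ToricVariety Ξ) {m : Fin n → ℤ} (h : PerpTo x.cone m) (k : ℤ) :
    x.val (k • m) = x.val m ^ k := by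
  obtain ⟨j, rfl | rfl⟩ := k.eq_nat_or_neg
  · simpa using x.val_nsmul h j
  · rw [neg_smul, val_neg x (h.zsmul _), zpow_neg, natCast_zsmul, val_nsmul x h, zpow_natCast]

theorem val_sum (x : ToricVariety Ξ) {ι : Type*} (s : Finset ι) (f : ι → Fin n → ℤ)
    (h : ∀ i ∈ s, PerpTo x.cone (f i)) :
    PerpTo x.cone (∑ i ∈ s, f i) ∧ x.val (∑ i ∈ s, f i) = ∏ i ∈ s, x.val (f i) := by
  classical
  induction s using Finset.induction_on with
  | empty => simpa using ⟨PerpTo.zero _, x.val_zero⟩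
  | insert a s ha ih =>
    obtain ⟨h1, h2⟩ := ih fun i hi => h i (Finset.mem_insert_of_mem hi)
    have h3 := h a (Finset.mem_insert_self a s)
    rw [Finset.sum_insert ha, Finset.prod_insert ha]
    exact ⟨h3.add h1, by rw [x.val_add _ _ h3 h1, h2]⟩

/-- The monomial function with the exponents `a`, with `0 ^ a i` replaced by `1`. -/
def unitMonomial (z : Fin n → ℂ) (a : Fin n → ℤ) : ℂ :=
  open Classical in ∏ i, (if z i = 0 then 1 else z i) ^ a i

theorem unitMonomial_ne_zero (z : Fin n → ℂ) (a : Fin n → ℤ) : unitMonomial z a ≠ 0 := by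
  refine Finset.prod_ne_zero_iff.2 fun i _ => zpow_ne_zero _ ?_
  split_ifs with h
  · exact one_ne_zero
  · exact h

variable (b : Module.Basis (Fin n) ℤ (Fin n → ℤ)) (J : Set (Fin n))

/-- The point of `X_σ`, where `σ` is the cone generated by the `b i`, `i ∈ J`, at which the
coordinates (the values at the dual basis) are `z`. It lies in the orbit of the face generated by
the `b i` with `i ∈ J` and `z i = 0`. -/
def ofCoords (hσ : basisCone b J ∈ Ξ.cones) (z : Fin n → ℂ) : ToricVariety Ξ where
  cone := basisCone b {i | i ∈ J ∧ z i = 0}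
  cone_mem := Ξ.face_mem _ hσ _ (basisCone_isFaceOf b fun _ hi => hi.1)
  val := fun m => open Classical in
    if PerpTo (basisCone b {i | i ∈ J ∧ z i = 0}) m then unitMonomial z (fun i => m ⬝ᵥ b i) else 0
  val_ne_zero_iff := fun m => by
    split_ifs with h
    · exact iff_of_true (unitMonomial_ne_zero _ _) h
    · exact iff_of_false (fun h' => h' rfl) h
  val_zero := by
    rw [if_pos (PerpTo.zero _)]
    simp [unitMonomial]
  val_add := fun m m' h h' => by
    rw [if_pos h, if_pos h', if_pos (h.add h')]
    simp only [unitMonomial, ← Finset.prod_mul_distrib]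
    refine Finset.prod_congr rfl fun i _ => ?_
    rw [add_dotProduct, zpow_add₀]
    split_ifs with hz
    · exact one_ne_zero
    · exact hz

/-- The chart of `X_Ξ` with domain `X_σ`, where `σ` is the cone generated by the `b i`, `i ∈ J`. It
evaluates a point at the basis of `M` dual to `b`, and so identifies `X_σ` with the set of the
`z ∈ ℂ^n` such that `z i ≠ 0` for `i ∉ J`, that is, with `ℂ^d × (ℂ^*)^(n-d)` for `d = dim σ`. -/
def affineChart (hσ : basisCone b J ∈ Ξ.cones) : PartialEquiv (ToricVariety Ξ) (Fin n → ℂ) where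
  toFun x := fun i => x.val (dualVec b i)
  invFun := ofCoords b J hσ
  source := {x | x.cone.IsFaceOf (basisCone b J)}
  target := {z | ∀ i, i ∉ J → z i ≠ 0}
  map_source' := by
    intro x hx i hi
    rw [x.val_ne_zero_iff, eq_basisCone_of_isFaceOf b hx, perpTo_dualVec_iff]
    exact fun h => hi h.1
  map_target' := fun z _ => basisCone_isFaceOf b fun _ hi => hi.1
  left_inv' := by
    intro x hx
    have hc := eq_basisCone_of_isFaceOf b hx
    have hz : ∀ i, x.val (dualVec b i) = 0 ↔ i ∈ J ∧ latticeVec (b i) ∈ x.cone := by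
      intro i
      have h1 := x.val_ne_zero_iff (dualVec b i)
      have h2 := perpTo_dualVec_iff b {j | j ∈ J ∧ latticeVec (b j) ∈ x.cone} i
      rw [← hc] at h2
      rw [← not_iff_not]
      exact h1.trans h2
    have hset : {i | i ∈ J ∧ x.val (dualVec b i) = 0}
        = {j | j ∈ J ∧ latticeVec (b j) ∈ x.cone} := by
      ext i
      simp only [Set.mem_ofPred_eq, hz]
      tauto
    have hcone : basisCone b {i | i ∈ J ∧ x.val (dualVec b i) = 0} = x.cone := by
      rw [hset, ← hc]
    refine ToricVariety.ext hcone (funext fun m => ?_)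
    change (open Classical in if PerpTo (basisCone b {i | i ∈ J ∧ x.val (dualVec b i) = 0}) m
      then unitMonomial (fun i => x.val (dualVec b i)) (fun i => m ⬝ᵥ b i) else 0) = x.val m
    rw [hcone]
    split_ifs with hm
    · have hm' : ∀ i, x.val (dualVec b i) = 0 → m ⬝ᵥ b i = 0 := by
        intro i hi
        have := hm
        rw [hc, perpTo_basisCone_iff] at this
        exact this i ((hz i).1 hi)
      have hp : ∀ i, PerpTo x.cone ((m ⬝ᵥ b i) • dualVec b i) := by
        intro i
        by_cases hi : x.val (dualVec b i) = 0
        · rw [hm' i hi, zero_smul]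
          exact PerpTo.zero _
        · exact ((x.val_ne_zero_iff _).1 hi).zsmul _
      conv_rhs => rw [eq_sum_dualVec b m]
      rw [(x.val_sum Finset.univ _ fun i _ => hp i).2]
      refine Finset.prod_congr rfl fun i _ => ?_
      by_cases hi : x.val (dualVec b i) = 0
      · change _ ^ (m ⬝ᵥ b i) = _
        rw [hm' i hi, zero_smul, x.val_zero, zpow_zero]
      · rw [if_neg hi, x.val_zsmul ((x.val_ne_zero_iff _).1 hi)]
    · by_contra h
      exact hm ((x.val_ne_zero_iff m).1 (Ne.symm h))
  right_inv' := by
    intro z hz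
    ext i
    change (open Classical in if PerpTo (basisCone b {i | i ∈ J ∧ z i = 0}) (dualVec b i)
      then unitMonomial z (fun j => dualVec b i ⬝ᵥ b j) else 0) = z i
    have hp := perpTo_dualVec_iff b {i | i ∈ J ∧ z i = 0} i
    by_cases hzi : z i ≠ 0
    · rw [if_pos (hp.2 fun h => hzi h.2)]
      unfold unitMonomial
      rw [Finset.prod_eq_single i]
      · rw [if_neg hzi]
        change z i ^ (dualVec b i ⬝ᵥ b i) = _
        rw [dualVec_dotProduct_basis, if_pos rfl, zpow_one]
      · intro j _ hj
        change _ ^ (dualVec b i ⬝ᵥ b j) = _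
        rw [dualVec_dotProduct_basis, if_neg (Ne.symm hj), zpow_zero]
      · intro h'
        exact absurd (Finset.mem_univ i) h'
    · have hi : i ∈ J := by
        by_contra hi
        exact hzi (hz i hi)
      rw [if_neg fun h => hp.1 h ⟨hi, not_not.1 hzi⟩]
      exact (not_not.1 hzi).symm

variable {b J}

/-- The domain of a coordinate change is cut out by the non-vanishing of some coordinates. -/
theorem mem_transition_source_iff {b' : Module.Basis (Fin n) ℤ (Fin n → ℤ)} {J' : Set (Fin n)}
    (hσ : basisCone b J ∈ Ξ.cones) (hσ' : basisCone b' J' ∈ Ξ.cones) (z : Fin n → ℂ) :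
    z ∈ ((affineChart b J hσ).symm.trans (affineChart b' J' hσ')).source ↔
      ∀ i, z i = 0 → i ∈ J ∧ latticeVec (b i) ∈ basisCone b' J' := by
  rw [PartialEquiv.trans_source]
  change ((∀ i, i ∉ J → z i ≠ 0) ∧
    (basisCone b {i | i ∈ J ∧ z i = 0}).IsFaceOf (basisCone b' J')) ↔ _
  constructor
  · rintro ⟨h1, h2⟩ i hi
    have hiJ : i ∈ J := by
      by_contra h
      exact h1 i h hi
    exact ⟨hiJ, h2.le (latticeVec_mem_basisCone b ⟨hiJ, hi⟩)⟩
  · intro h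
    refine ⟨fun i hi h0 => hi (h i h0).1, ?_⟩
    obtain ⟨f1, f2⟩ := Ξ.inter_face _ hσ _ hσ'
    refine PointedCone.IsFaceOf.trans ?_ f2
    rw [eq_basisCone_of_isFaceOf b f1]
    refine basisCone_isFaceOf b fun i hi => ⟨hi.1, ?_⟩
    exact Submodule.mem_inf.2 ⟨latticeVec_mem_basisCone b hi.1, (h i hi.2).2⟩

/-- A coordinate change is given by Laurent monomials. -/
theorem transition_apply {b' : Module.Basis (Fin n) ℤ (Fin n → ℤ)} {J' : Set (Fin n)}
    (hσ : basisCone b J ∈ Ξ.cones) (hσ' : basisCone b' J' ∈ Ξ.cones) {z : Fin n → ℂ}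
    (hz : z ∈ ((affineChart b J hσ).symm.trans (affineChart b' J' hσ')).source) (k : Fin n) :
    ((affineChart b J hσ).symm.trans (affineChart b' J' hσ')) z k
      = ∏ i, z i ^ (dualVec b' k ⬝ᵥ b i) := by
  rw [mem_transition_source_iff] at hz
  change (open Classical in if PerpTo (basisCone b {i | i ∈ J ∧ z i = 0}) (dualVec b' k)
      then unitMonomial z (fun j => dualVec b' k ⬝ᵥ b j) else 0) = _
  split_ifs with h
  · rw [perpTo_basisCone_iff] at h
    refine Finset.prod_congr rfl fun i _ => ?_
    split_ifs with hi
    · change 1 ^ (dualVec b' k ⬝ᵥ b i) = _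
      rw [h i ⟨(hz i hi).1, hi⟩, zpow_zero, zpow_zero]
    · rfl
  · rw [perpTo_basisCone_iff] at h
    push Not at h
    obtain ⟨i, ⟨_, hi⟩, hne⟩ := h
    exact (Finset.prod_eq_zero (Finset.mem_univ i) (by rw [hi, zero_zpow _ hne])).symm

theorem isOpen_transition_source {b' : Module.Basis (Fin n) ℤ (Fin n → ℤ)} {J' : Set (Fin n)}
    (hσ : basisCone b J ∈ Ξ.cones) (hσ' : basisCone b' J' ∈ Ξ.cones) :
    IsOpen ((affineChart b J hσ).symm.trans (affineChart b' J' hσ')).source := by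
  have : ((affineChart b J hσ).symm.trans (affineChart b' J' hσ')).source
      = ⋂ i : Fin n, {z | ¬ (i ∈ J ∧ latticeVec (b i) ∈ basisCone b' J') → z i ≠ 0} := by
    ext z
    rw [mem_transition_source_iff]
    simp only [Set.mem_iInter, Set.mem_ofPred_eq]
    exact forall_congr' fun i => by tauto
  rw [this]
  refine isOpen_iInter_of_finite fun i => ?_
  by_cases h : i ∈ J ∧ latticeVec (b i) ∈ basisCone b' J'
  · simp [h]
  · simpa only [h, not_false_eq_true, forall_true_left] using
      isOpen_ne_fun (continuous_apply i) continuous_const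

theorem contDiffOn_transition {b' : Module.Basis (Fin n) ℤ (Fin n → ℤ)} {J' : Set (Fin n)}
    (hσ : basisCone b J ∈ Ξ.cones) (hσ' : basisCone b' J' ∈ Ξ.cones) :
    ContDiffOn ℂ ω ((affineChart b J hσ).symm.trans (affineChart b' J' hσ'))
      ((affineChart b J hσ).symm.trans (affineChart b' J' hσ')).source := by
  have key : ContDiffOn ℂ ω (fun z : Fin n → ℂ => fun k => ∏ i, z i ^ (dualVec b' k ⬝ᵥ b i))
      ((affineChart b J hσ).symm.trans (affineChart b' J' hσ')).source := by
    intro z hz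
    rw [mem_transition_source_iff] at hz
    refine ContDiffAt.contDiffWithinAt (contDiffAt_pi.2 fun k => ?_)
    refine contDiffAt_prod fun i _ => ?_
    have hpr : AnalyticAt ℂ (fun w : Fin n → ℂ => w i) z :=
      (ContinuousLinearMap.proj (R := ℂ) (φ := fun _ : Fin n => ℂ) i).analyticAt z
    by_cases hi : z i = 0
    · have h0 : 0 ≤ dualVec b' k ⬝ᵥ b i := by
        have := ((mem_basisCone_iff b' J' _).1 (hz i hi).2 k).1
        rw [latticePairing_latticeVec] at this
        exact_mod_cast this
      exact (hpr.fun_zpow_nonneg h0).contDiffAt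
    · exact (hpr.fun_zpow hi).contDiffAt
  exact key.congr fun z hz => funext fun k => transition_apply hσ hσ' hz k

variable (Ξ) in
/-- The atlas of `X_Ξ`: one chart for each `ℤ`-basis `b` of `N` and each `J` such that the cone
generated by the `b i`, `i ∈ J`, belongs to the fan. -/
def chartCore : ChartedSpaceCore (Fin n → ℂ) (ToricVariety Ξ) where
  atlas := {e | ∃ (b : Module.Basis (Fin n) ℤ (Fin n → ℤ)) (J : Set (Fin n))
    (hσ : basisCone b J ∈ Ξ.cones), e = affineChart b J hσ}
  chartAt x :=
    affineChart (Ξ.nonsingular _ x.cone_mem).choose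
      (Ξ.nonsingular _ x.cone_mem).choose_spec.choose
      ((Ξ.nonsingular _ x.cone_mem).choose_spec.choose_spec ▸ x.cone_mem)
  mem_chart_source x := by
    change x.cone.IsFaceOf _
    rw [← (Ξ.nonsingular _ x.cone_mem).choose_spec.choose_spec]
  chart_mem_atlas x := ⟨_, _, _, rfl⟩
  open_source := by
    rintro _ _ ⟨b, J, hσ, rfl⟩ ⟨b', J', hσ', rfl⟩
    exact isOpen_transition_source hσ hσ'
  continuousOn_toFun := by
    rintro _ _ ⟨b, J, hσ, rfl⟩ ⟨b', J', hσ', rfl⟩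
    exact (contDiffOn_transition hσ hσ').continuousOn

instance : TopologicalSpace (ToricVariety Ξ) := (chartCore Ξ).toTopologicalSpace

instance : ChartedSpace (Fin n → ℂ) (ToricVariety Ξ) := (chartCore Ξ).toChartedSpace

/-- `X_Ξ` is a complex manifold of dimension `n`. -/
instance : IsManifold 𝓘(ℂ, Fin n → ℂ) ω (ToricVariety Ξ) := by
  refine isManifold_of_contDiffOn _ _ _ ?_
  intro e e' he he'
  obtain ⟨_, ⟨e₀, rfl⟩, _, ⟨⟨b, J, hσ, rfl⟩, rfl⟩, rfl⟩ := he
  obtain ⟨_, ⟨e₁, rfl⟩, _, ⟨⟨b', J', hσ', rfl⟩, rfl⟩, rfl⟩ := he'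
  simp only [modelWithCornersSelf_coe, modelWithCornersSelf_coe_symm, Set.range_id, Set.inter_univ,
    Set.preimage_id, Function.comp_id, Function.id_comp]
  exact contDiffOn_transition hσ hσ'

end ToricVariety

/-! ### Holomorphic equivariant principal bundles -/

/-- A discrete group as a complex manifold of dimension zero. -/
instance discreteChartedSpace {G : Type*} [TopologicalSpace G] [DiscreteTopology G] :
    ChartedSpace (Fin 0 → ℂ) G :=
  ChartedSpace.ofDiscreteTopology

/-- A discrete group is a complex Lie group of dimension zero. -/
instance discreteLieGroup {G : Type*} [Group G] [TopologicalSpace G] [DiscreteTopology G] :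
    LieGroup 𝓘(ℂ, Fin 0 → ℂ) ω G where
  toIsManifold := IsManifold.of_discreteTopology ω
  contMDiff_mul := contMDiff_of_discreteTopology
  contMDiff_inv := contMDiff_of_discreteTopology

section Bundles

variable {n : ℕ}
  {A : Type*} [NormedAddCommGroup A] [NormedSpace ℂ A]
  {G : Type*} [Group G] [TopologicalSpace G] [ChartedSpace A G] [LieGroup 𝓘(ℂ, A) ω G]
  {B : Type*} [NormedAddCommGroup B] [NormedSpace ℂ B]
  {X : Type*} [TopologicalSpace X] [ChartedSpace B X] [IsManifold 𝓘(ℂ, B) ω X]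
  [MulAction (Torus n) X]
  {C : Type*} [NormedAddCommGroup C] [NormedSpace ℂ C]
  {E : Type*} [TopologicalSpace E] [ChartedSpace C E] [IsManifold 𝓘(ℂ, C) ω E]
  [MulAction (Torus n) E] [MulAction Gᵐᵒᵖ E]

variable (n A G B C) in
/-- `π : E → X` is a holomorphic `T`-equivariant principal `G`-bundle, where `T = (ℂ^*)^n`, `G` is a
complex Lie group (modelled on `A`) and `X`, `E` are complex manifolds (modelled on `B`, `C`). The
group `T` acts on `X` and on `E` from the left, and `G` acts on `E` from the right; the right action
`e · g` is written `MulOpposite.op g • e`. -/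
structure IsHolomorphicEquivariantPrincipalBundle (π : E → X) : Prop where
  holomorphic_proj : ContMDiff 𝓘(ℂ, C) 𝓘(ℂ, B) ω π
  holomorphic_torus_action : ContMDiff (𝓘(ℂ, Fin n → ℂ).prod 𝓘(ℂ, C)) 𝓘(ℂ, C) ω
    (fun p : Torus n × E => p.1 • p.2)
  holomorphic_right_action : ContMDiff (𝓘(ℂ, C).prod 𝓘(ℂ, A)) 𝓘(ℂ, C) ω
    (fun p : E × G => MulOpposite.op p.2 • p.1)
  proj_right_action : ∀ (e : E) (g : G), π (MulOpposite.op g • e) = π e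
  proj_torus_action : ∀ (t : Torus n) (e : E), π (t • e) = t • π e
  actions_commute : ∀ (t : Torus n) (e : E) (g : G),
    t • (MulOpposite.op g • e) = MulOpposite.op g • (t • e)
  /-- Around every point of `X` there is a biholomorphic trivialization `π⁻¹(U) ≅ U × G` over `U`
  which is equivariant for the right action of `G`. -/
  locally_trivial : ∀ x : X, ∃ φ : Bundle.Trivialization G π, x ∈ φ.baseSet ∧
    ContMDiffOn 𝓘(ℂ, C) (𝓘(ℂ, B).prod 𝓘(ℂ, A)) ω φ φ.source ∧
    ContMDiffOn (𝓘(ℂ, B).prod 𝓘(ℂ, A)) 𝓘(ℂ, C) ω φ.toOpenPartialHomeomorph.symm φ.target ∧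
    ∀ e ∈ φ.source, ∀ g : G, (φ (MulOpposite.op g • e)).2 = (φ e).2 * g

/-- A biholomorphic map `Φ : E ≅ X × G` is a (global) trivialization of the principal `G`-bundle
`π : E → X` if it is a map over `X` and is equivariant for the right actions of `G`, the one on
`X × G` being `(x, h) · g = (x, h g)`. -/
def IsPrincipalTrivialization (π : E → X)
    (Φ : Diffeomorph 𝓘(ℂ, C) (𝓘(ℂ, B).prod 𝓘(ℂ, A)) E (X × G) ω) : Prop :=
  (∀ e, (Φ e).1 = π e) ∧ ∀ (e : E) (g : G), (Φ (MulOpposite.op g • e)).2 = (Φ e).2 * g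

variable (n) in
/-- In the trivialization `Φ` the torus acts trivially on the fibre `G`, that is, its action on
`X × G` is `t (x, h) = (t x, h)`. -/
def TorusActsTrivially (Φ : Diffeomorph 𝓘(ℂ, C) (𝓘(ℂ, B).prod 𝓘(ℂ, A)) E (X × G) ω) : Prop :=
  ∀ (t : Torus n) (e : E), Φ (t • e) = (t • (Φ e).1, (Φ e).2)

end Bundles

end

/-! The open orbit is a torsor under the torus. Moving a point `e₀` of the fibre over the base point
by the torus therefore gives a section of the bundle over the open orbit, equivalently a
`G`-equivariant continuous map `f₀` from the restricted bundle to `G`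
(`exists_continuousOn_openOrbit`). Equivariance is essential here: the open orbit need not be simply
connected, and a bundle without torus action may have monodromy.

To extend `f₀` over the boundary, note that in an affine chart the open orbit is the complement of
the coordinate hyperplanes. These have real codimension two, so every point of the toric variety has
arbitrarily small neighbourhoods meeting the orbit in a connected nonempty set
(`exists_nhds_isConnected_inter_openOrbit`). On a sheet of a local trivialization over such a trace,
`f₀` is a continuous map from a connected set to a discrete one, hence constant, and so extends
uniquely (`exists_continuous_extension`).

The extension `f` is equivariant and locally constant, so `(π, f)` is a biholomorphic
trivialization. In any trivialization the fibre coordinate of `t • e` is a continuous function of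
`t` from a connected group to a discrete one, so it keeps its value at `t = 1`. -/

open Filter Topology

/-! ### Local connectedness of the complement of the coordinate hyperplanes -/

namespace Complex

/-- The punctured disc is connected. -/
theorem isPreconnected_ball_zero_diff_zero {r : ℝ} (hr : 0 < r) :
    IsPreconnected (Metric.ball (0 : ℂ) r \ {0}) := by
  -- The punctured disc is not convex, but `exp` maps a half-plane, which is convex, onto it.
  have h : Metric.ball (0 : ℂ) r \ {0} = Complex.exp '' {w | w.re < Real.log r} := by
    ext z
    simp only [Set.mem_sdiff, Metric.mem_ball, dist_zero_right, Set.mem_singleton_iff,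
      Set.mem_image, Set.mem_ofPred_eq]
    constructor
    · rintro ⟨hz, hz0⟩
      refine ⟨Complex.log z, ?_, Complex.exp_log hz0⟩
      rw [Complex.log_re]
      exact Real.log_lt_log (norm_pos_iff.2 hz0) hz
    · rintro ⟨w, hw, rfl⟩
      refine ⟨?_, Complex.exp_ne_zero w⟩
      rw [Complex.norm_exp]
      exact (Real.lt_log_iff_exp_lt hr).1 hw
  rw [h]
  exact (convex_halfSpace_re_lt _).isPreconnected.image _ Complex.continuous_exp.continuousOn

/-- A ball centred at `z` works: at `z = 0` it becomes a punctured disc, and elsewhere a radius of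
at most `‖z‖` keeps it away from `0`. -/
theorem exists_nhds_isConnected_diff_zero (z : ℂ) {s : Set ℂ} (hs : s ∈ 𝓝 z) :
    ∃ u ∈ 𝓝 z, u ⊆ s ∧ IsConnected (u \ {0}) := by
  obtain ⟨ε, hε, hεs⟩ := Metric.mem_nhds_iff.1 hs
  by_cases hz : z = 0
  · subst hz
    refine ⟨_, Metric.ball_mem_nhds _ hε, hεs, ⟨((ε / 2 : ℝ) : ℂ), ?_⟩,
      isPreconnected_ball_zero_diff_zero hε⟩
    have h2 : (0 : ℝ) < ε / 2 := half_pos hε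
    refine ⟨?_, by simpa using hε.ne'⟩
    rw [mem_ball_zero_iff, Complex.norm_real, Real.norm_of_nonneg h2.le]
    exact half_lt_self hε
  · have h0 : (0 : ℂ) ∉ Metric.ball z (min ε ‖z‖) := by
      simp [dist_eq_norm]
    have hpos : 0 < min ε ‖z‖ := lt_min hε (norm_pos_iff.2 hz)
    refine ⟨_, Metric.ball_mem_nhds _ hpos,
      (Metric.ball_subset_ball (min_le_left _ _)).trans hεs, ?_⟩
    rw [Set.sdiff_singleton_eq_self h0]
    exact Metric.isConnected_ball hpos

end Complex

/-- The complement of the coordinate hyperplanes in `ℂ^n` is locally connected at every point of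
`ℂ^n`. -/
theorem exists_nhds_isConnected_inter_ne_zero {ι : Type*} [Finite ι] (z : ι → ℂ)
    {s : Set (ι → ℂ)} (hs : s ∈ 𝓝 z) :
    ∃ u ∈ 𝓝 z, u ⊆ s ∧ IsConnected (u ∩ {w | ∀ i, w i ≠ 0}) := by
  have := Fintype.ofFinite ι
  rw [nhds_pi, Filter.mem_pi'] at hs
  obtain ⟨I, t, ht, hts⟩ := hs
  choose u hu hut huc using fun i => Complex.exists_nhds_isConnected_diff_zero (z i) (ht i)
  refine ⟨Set.univ.pi u, set_pi_mem_nhds Set.finite_univ fun i _ => hu i,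
    fun w hw => hts fun i _ => hut i (hw i trivial), ?_⟩
  -- The condition separates into the coordinates, so the trace of a box is a product of connected
  -- sets.
  have : Set.univ.pi u ∩ {w | ∀ i, w i ≠ 0} = Set.univ.pi fun i => u i \ {0} := by
    ext w
    simp [forall_and]
  rw [this]
  exact isConnected_univ_pi.2 huc

/-! ### Principal bundles with discrete structure group -/

section LocallyConstant

variable {E X G : Type*} [TopologicalSpace E] [TopologicalSpace X]
  [Group G] [TopologicalSpace G] [MulAction Gᵐᵒᵖ E] {π : E → X}

/-- `π : E → X` is a principal bundle for the discrete group `G`. -/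
structure IsDiscretePrincipalBundle (G : Type*) [Group G] [TopologicalSpace G]
    [MulAction Gᵐᵒᵖ E] (π : E → X) : Prop where
  continuous_smul : ∀ g : Gᵐᵒᵖ, Continuous fun e : E => g • e
  proj_smul : ∀ (g : Gᵐᵒᵖ) (e : E), π (g • e) = π e
  locally_trivial : ∀ x : X, ∃ φ : Bundle.Trivialization G π, x ∈ φ.baseSet ∧
    ∀ e ∈ φ.source, ∀ g : G, (φ (MulOpposite.op g • e)).2 = (φ e).2 * g

namespace IsDiscretePrincipalBundle

theorem proj_surjective (hπ : IsDiscretePrincipalBundle G π) : Function.Surjective π := by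
  intro x
  obtain ⟨φ, hx, -⟩ := hπ.locally_trivial x
  exact ⟨φ.toOpenPartialHomeomorph.symm (x, 1), φ.proj_symm_apply' hx⟩

/-- In a local trivialization `G` acts by right multiplication on the fibre coordinate, so the
quotient of the two fibre coordinates is the required element. -/
theorem exists_smul_eq (hπ : IsDiscretePrincipalBundle G π) {e e' : E} (h : π e = π e') :
    ∃ g : G, e' = MulOpposite.op g • e := by
  obtain ⟨φ, hx, hφ⟩ := hπ.locally_trivial (π e)
  have he : e ∈ φ.source := φ.mem_source.2 hx
  have he' : e' ∈ φ.source := φ.mem_source.2 (h ▸ hx)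
  refine ⟨(φ e).2⁻¹ * (φ e').2, φ.injOn he' ?_ ?_⟩
  · rw [φ.mem_source, hπ.proj_smul]; exact hx
  · change φ e' = φ (MulOpposite.op ((φ e).2⁻¹ * (φ e').2) • e)
    refine Prod.ext ?_ ?_
    · rw [φ.coe_fst he', φ.coe_fst' (by rw [hπ.proj_smul]; exact hx), hπ.proj_smul, h]
    · rw [hφ e he, mul_inv_cancel_left]

theorem op_smul_injective (hπ : IsDiscretePrincipalBundle G π) (e : E) :
    Function.Injective fun g : G => MulOpposite.op g • e := by
  intro g g' h
  obtain ⟨φ, hx, hφ⟩ := hπ.locally_trivial (π e)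
  have he : e ∈ φ.source := φ.mem_source.2 hx
  have h' : (φ (MulOpposite.op g • e)).2 = (φ (MulOpposite.op g' • e)).2 := by
    rw [show MulOpposite.op g • e = MulOpposite.op g' • e from h]
  rw [hφ e he, hφ e he] at h'
  exact mul_left_cancel h'

/-- An equivariant map to `G` which is defined and continuous over a subset of the base with
locally connected traces extends to the whole bundle. -/
theorem exists_continuous_extension [DiscreteTopology G] (hπ : IsDiscretePrincipalBundle G π) {D : Set X}
    (hD : ∀ x, ∀ s ∈ 𝓝 x, ∃ u ∈ 𝓝 x, u ⊆ s ∧ IsConnected (u ∩ D))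
    {f₀ : E → G} (hf₀ : ContinuousOn f₀ (π ⁻¹' D))
    (heq : ∀ e, π e ∈ D → ∀ g : G, f₀ (MulOpposite.op g • e) = f₀ e * g) :
    ∃ f : E → G, Continuous f ∧ ∀ (e : E) (g : G), f (MulOpposite.op g • e) = f e * g := by
  -- Density of `D`, which holds because connected traces are nonempty, lifts to `E` since a local
  -- trivialization carries neighbourhoods of `e` onto neighbourhoods of `π e`.
  have hfreq : ∀ e : E, ∃ᶠ e' in 𝓝 e, π e' ∈ D := by
    intro e
    obtain ⟨φ, hx, -⟩ := hπ.locally_trivial (π e)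
    have h : ∃ᶠ x in 𝓝 (π e), x ∈ D := by
      refine Filter.frequently_iff.2 fun {s} hs => ?_
      obtain ⟨u, -, hus, ⟨x, hxu, hxD⟩, -⟩ := hD _ s hs
      exact ⟨x, hus hxu, hxD⟩
    rwa [← φ.map_proj_nhds (φ.mem_source.2 hx), Filter.frequently_map] at h
  have hloc : ∀ e : E, ∃ c : G, ∀ᶠ e' in 𝓝 e, π e' ∈ D → f₀ e' = c := by
    intro e
    obtain ⟨φ, hx, -⟩ := hπ.locally_trivial (π e)
    have he : e ∈ φ.source := φ.mem_source.2 hx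
    obtain ⟨u, hu, hus, ⟨x₀, hx₀⟩, huc⟩ := hD _ _ (φ.open_baseSet.mem_nhds hx)
    -- The sheet through `e`. As `G` is discrete, it contains all points near `e`, and `f₀` is
    -- constant on its part over the connected set `u ∩ D`.
    let s : X → E := fun x => φ.toOpenPartialHomeomorph.symm (x, (φ e).2)
    have hsc : ContinuousOn (fun x => f₀ (s x)) (u ∩ D) := by
      refine hf₀.comp (φ.continuousOn_symm_prodMk_left.mono fun x hx => hus hx.1) ?_
      intro x hx
      change π (s x) ∈ D
      rw [φ.proj_symm_apply' (hus hx.1)]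
      exact hx.2
    refine ⟨f₀ (s x₀), ?_⟩
    have h1 : ∀ᶠ e' in 𝓝 e, π e' ∈ u := (φ.continuousAt_proj he) hu
    have h2 : ∀ᶠ e' in 𝓝 e, (φ e').2 = (φ e).2 := by
      have : ContinuousAt (fun e' => (φ e').2) e :=
        continuousAt_snd.comp (φ.toOpenPartialHomeomorph.continuousAt he)
      exact this (IsOpen.mem_nhds (isOpen_discrete {(φ e).2}) rfl)
    filter_upwards [h1, h2] with e' h1 h2 hD'
    have he' : e' = s (π e') := by
      change e' = φ.toOpenPartialHomeomorph.symm (π e', (φ e).2)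
      rw [← h2, φ.symm_apply_mk_proj (φ.mem_source.2 (hus h1))]
    rw [he']
    exact huc.constant hsc ⟨h1, hD'⟩ hx₀
  choose f hf using hloc
  refine ⟨f, continuous_iff_continuousAt.2 fun e => ?_, fun e g => ?_⟩
  · have h : ∀ᶠ e' in 𝓝 e, f e' = f e := by
      filter_upwards [eventually_eventually_nhds.2 (hf e)] with e' he'
      obtain ⟨e'', hD'', h1, h2⟩ := ((hfreq e').and_eventually (he'.and (hf e'))).exists
      rw [← h1 hD'', h2 hD'']
    exact continuousAt_const.congr (h.mono fun _ h => h.symm)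
  -- Equivariance is inherited from `f₀` at a point `e'` over `D` near `e`, whose translate by `g`
  -- is near that of `e`.
  · have h := (hπ.continuous_smul (MulOpposite.op g)).continuousAt.eventually
      (hf (MulOpposite.op g • e))
    obtain ⟨e', hD', h1, h2⟩ := ((hfreq e).and_eventually (h.and (hf e))).exists
    rw [← h1 (by rwa [hπ.proj_smul]), ← h2 hD', heq e' hD']

end IsDiscretePrincipalBundle

end LocallyConstant

/-! ### Connectedness and coordinates of the torus; the dual lattice basis -/

namespace Torus

variable {n : ℕ}

instance : PreconnectedSpace (Torus n) :=
  inferInstanceAs (PreconnectedSpace (Fin n → ℂˣ))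

theorem character_single (t : Torus n) (i : Fin n) : character (Pi.single i 1) t = t i := by
  rw [character, Finset.prod_eq_single i]
  · simp
  · intro j _ hj
    simp [Pi.single_eq_of_ne hj]
  · simp

end Torus

theorem dualVec_basisFun {n : ℕ} (i : Fin n) :
    dualVec (Pi.basisFun ℤ (Fin n)) i = Pi.single i 1 := by
  ext k
  simp [dualVec, Pi.single_apply, eq_comm]

theorem perpTo_of_perpTo_dualVec {n : ℕ} (b : Module.Basis (Fin n) ℤ (Fin n → ℤ))
    {τ : PointedCone ℝ (Fin n → ℝ)} (h : ∀ i, PerpTo τ (dualVec b i)) (m : Fin n → ℤ) :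
    PerpTo τ m := by
  intro v hv
  have hv0 : v = 0 := by
    rw [eq_sum_latticeVec b v]
    exact Finset.sum_eq_zero fun i _ => by rw [h i v hv, zero_smul]
  simp [hv0, latticePairing]

/-! ### The open orbit: its boundary and its torsor structure -/

namespace ToricVariety

variable {n : ℕ} {Ξ : NonsingularFan n}

/-- The open orbit of the torus. -/
def openOrbit (Ξ : NonsingularFan n) : Set (ToricVariety Ξ) := {x | ∀ m, x.val m ≠ 0}

theorem smul_val (t : Torus n) (x : ToricVariety Ξ) (m : Fin n → ℤ) :
    (t • x).val m = Torus.character m t * x.val m := rfl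

theorem smul_mem_openOrbit {t : Torus n} {x : ToricVariety Ξ} (hx : x ∈ openOrbit Ξ) :
    t • x ∈ openOrbit Ξ :=
  fun m => mul_ne_zero (Torus.character_ne_zero m t) (hx m)

variable (b : Module.Basis (Fin n) ℤ (Fin n → ℤ)) (J : Set (Fin n))

/-- Nonvanishing means orthogonality to the cone of `x`, and a cone orthogonal to a basis of `M` is
zero. This describes the open orbit in every affine chart as the locus of nonzero coordinates. -/
theorem mem_openOrbit_iff (x : ToricVariety Ξ) :
    x ∈ openOrbit Ξ ↔ ∀ i, x.val (dualVec b i) ≠ 0 :=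
  ⟨fun h _ => h _, fun h m => (x.val_ne_zero_iff m).2
    (perpTo_of_perpTo_dualVec b (fun i => (x.val_ne_zero_iff _).1 (h i)) m)⟩

variable {b J} in
/-- An affine chart as a local homeomorphism. -/
noncomputable def affineHomeomorph (hσ : basisCone b J ∈ Ξ.cones) :
    OpenPartialHomeomorph (ToricVariety Ξ) (Fin n → ℂ) :=
  (chartCore Ξ).openPartialHomeomorph (affineChart b J hσ) ⟨b, J, hσ, rfl⟩

/-- The open orbit is dense and locally connected along its boundary. -/
theorem exists_nhds_isConnected_inter_openOrbit (x : ToricVariety Ξ) {s : Set (ToricVariety Ξ)}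
    (hs : s ∈ 𝓝 x) : ∃ u ∈ 𝓝 x, u ⊆ s ∧ IsConnected (u ∩ openOrbit Ξ) := by
  obtain ⟨b, J, hσ⟩ := Ξ.nonsingular _ x.cone_mem
  have hσ' : basisCone b J ∈ Ξ.cones := hσ ▸ x.cone_mem
  let e := affineHomeomorph hσ'
  have hx : x ∈ e.source := by
    change x.cone.IsFaceOf (basisCone b J)
    rw [← hσ]
  -- Staying inside `e.target` makes `e.symm` continuous on `u` and inverse to `e` there.
  have hmem : e.symm ⁻¹' s ∩ e.target ∈ 𝓝 (e x) := by
    refine inter_mem ?_ (e.open_target.mem_nhds (e.map_source hx))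
    refine e.continuousAt_symm (e.map_source hx) ?_
    rwa [e.left_inv hx]
  obtain ⟨u, hu, hus, huc⟩ := exists_nhds_isConnected_inter_ne_zero (e x) hmem
  refine ⟨e.symm '' u, ?_, ?_, ?_⟩
  · have := e.symm.image_mem_nhds (e.map_source hx) hu
    rwa [e.left_inv hx] at this
  · rintro _ ⟨z, hz, rfl⟩
    exact (hus hz).1
  · have himage : e.symm '' u ∩ openOrbit Ξ = e.symm '' (u ∩ {w | ∀ i, w i ≠ 0}) := by
      have hiff : ∀ z ∈ u, e.symm z ∈ openOrbit Ξ ↔ ∀ i, z i ≠ 0 := by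
        intro z hz
        conv_rhs => rw [← e.right_inv (hus hz).2]
        exact mem_openOrbit_iff b _
      ext y
      constructor
      · rintro ⟨⟨z, hz, rfl⟩, hy⟩
        exact ⟨z, ⟨hz, (hiff z hz).1 hy⟩, rfl⟩
      · rintro ⟨z, ⟨hz, hz0⟩, rfl⟩
        exact ⟨⟨z, hz, rfl⟩, (hiff z hz).2 hz0⟩
    rw [himage]
    exact huc.image _ (e.continuousOn_symm.mono fun z hz => (hus hz.1).2)

/-- The zero cone does not depend on the basis and is a face of any member of the fan, which is
nonempty. -/
theorem basisCone_empty_mem : basisCone b ∅ ∈ Ξ.cones := by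
  obtain ⟨σ, hσ⟩ := Ξ.nonempty
  obtain ⟨b', J', rfl⟩ := Ξ.nonsingular σ hσ
  have h : basisCone b ∅ = basisCone b' ∅ := by simp [basisCone]
  rw [h]
  exact Ξ.face_mem _ hσ _ (basisCone_isFaceOf b' (Set.empty_subset J'))

variable (Ξ) in
/-- The affine chart of the open orbit. -/
noncomputable def orbitChart : OpenPartialHomeomorph (ToricVariety Ξ) (Fin n → ℂ) :=
  affineHomeomorph (basisCone_empty_mem (Pi.basisFun ℤ (Fin n)))

theorem orbitChart_apply (x : ToricVariety Ξ) (i : Fin n) :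
    orbitChart Ξ x i = x.val (Pi.single i 1) := by
  rw [← dualVec_basisFun]
  rfl

/-- Both sides say that the cone of the point is zero: the only face of the zero cone is itself, and
a cone orthogonal to the standard basis of `M` vanishes. -/
theorem orbitChart_source : (orbitChart Ξ).source = openOrbit Ξ := by
  ext x
  change x.cone.IsFaceOf (basisCone (Pi.basisFun ℤ (Fin n)) ∅) ↔ _
  constructor
  · intro h m
    rw [x.val_ne_zero_iff]
    intro v hv
    have := h.le hv
    simp only [basisCone, Set.image_empty, PointedCone.hull, Submodule.span_empty,
      Submodule.mem_bot] at this
    simp [this, latticePairing]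
  · intro h
    have : x.cone = basisCone (Pi.basisFun ℤ (Fin n)) ∅ := by
      rw [basisCone, Set.image_empty, PointedCone.hull, Submodule.span_empty, eq_bot_iff]
      intro v hv
      rw [Submodule.mem_bot]
      ext i
      have := (x.val_ne_zero_iff _).1 (h (Pi.single i 1)) v hv
      simpa [latticePairing, Pi.single_apply] using this
    rw [this]

variable (Ξ) in
/-- The unit of the torus as a point of the open orbit. -/
noncomputable def basePoint : ToricVariety Ξ := (orbitChart Ξ).symm 1

theorem one_mem_orbitChart_target : (1 : Fin n → ℂ) ∈ (orbitChart Ξ).target :=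
  fun _ _ => one_ne_zero

theorem basePoint_mem : basePoint Ξ ∈ openOrbit Ξ := by
  rw [← orbitChart_source]
  exact (orbitChart Ξ).map_target one_mem_orbitChart_target

theorem basePoint_val_single (i : Fin n) : (basePoint Ξ).val (Pi.single i 1) = 1 := by
  rw [← orbitChart_apply, basePoint, (orbitChart Ξ).right_inv one_mem_orbitChart_target]
  rfl

/-- The coordinates of a point of the open orbit as an element of the torus; junk elsewhere. -/
noncomputable def toTorus (x : ToricVariety Ξ) : Torus n := fun i =>
  open Classical in if h : x.val (Pi.single i 1) ≠ 0 then Units.mk0 _ h else 1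

theorem toTorus_apply {x : ToricVariety Ξ} (hx : x ∈ openOrbit Ξ) (i : Fin n) :
    (toTorus x i : ℂ) = x.val (Pi.single i 1) := by
  rw [toTorus, dif_pos (hx _), Units.val_mk0]

/-- The torus multiplies the standard coordinates by its own, those of the base point are all `1`,
and these coordinates separate the points of the open orbit. -/
theorem toTorus_smul_basePoint {x : ToricVariety Ξ} (hx : x ∈ openOrbit Ξ) :
    toTorus x • basePoint Ξ = x := by
  refine (orbitChart Ξ).injOn ?_ ?_ (funext fun i => ?_)
  · rw [orbitChart_source]
    exact smul_mem_openOrbit basePoint_mem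
  · rwa [orbitChart_source]
  · rw [orbitChart_apply, orbitChart_apply, smul_val, Torus.character_single,
      basePoint_val_single, mul_one, toTorus_apply hx]

/-- The torus carries the topology induced from `ℂ^n`, and followed by this inclusion `toTorus` is
the chart of the open orbit. -/
theorem continuousOn_toTorus : ContinuousOn (toTorus : ToricVariety Ξ → Torus n) (openOrbit Ξ) := by
  rw [Torus.isOpenEmbedding_coords.isInducing.continuousOn_iff, ← orbitChart_source]
  refine (orbitChart Ξ).continuousOn.congr fun x hx => funext fun i => ?_
  rw [orbitChart_source] at hx
  exact (toTorus_apply hx i).trans (orbitChart_apply x i).symm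

end ToricVariety

/-! ### Trivialization of equivariant bundles -/

section EquivariantBundle

variable {n : ℕ} {Ξ : NonsingularFan n}
  {G : Type*} [Group G] [TopologicalSpace G] [DiscreteTopology G]
  {C : Type*} [NormedAddCommGroup C] [NormedSpace ℂ C]
  {E : Type*} [TopologicalSpace E] [ChartedSpace C E]
  [MulAction (Torus n) E] [MulAction Gᵐᵒᵖ E]
  {π : E → ToricVariety Ξ}

namespace IsHolomorphicEquivariantPrincipalBundle

theorem isDiscretePrincipalBundle
    (hπ : IsHolomorphicEquivariantPrincipalBundle n (Fin 0 → ℂ) G (Fin n → ℂ) C π) :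
    IsDiscretePrincipalBundle G π where
  continuous_smul g :=
    hπ.holomorphic_right_action.continuous.comp (continuous_id.prodMk continuous_const :
      Continuous fun e : E => (e, g.unop))
  proj_smul g e := hπ.proj_right_action e g.unop
  locally_trivial x := by
    obtain ⟨φ, hx, -, -, hφ⟩ := hπ.locally_trivial x
    exact ⟨φ, hx, hφ⟩

theorem continuous_torus_smul
    (hπ : IsHolomorphicEquivariantPrincipalBundle n (Fin 0 → ℂ) G (Fin n → ℂ) C π) :
    Continuous fun p : Torus n × E => p.1 • p.2 :=
  hπ.holomorphic_torus_action.continuous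

/-- Over the open orbit, which is a torsor under the torus, the bundle is trivial. -/
theorem exists_continuousOn_openOrbit
    (hπ : IsHolomorphicEquivariantPrincipalBundle n (Fin 0 → ℂ) G (Fin n → ℂ) C π) :
    ∃ f : E → G, ContinuousOn f (π ⁻¹' ToricVariety.openOrbit Ξ) ∧
      ∀ e, π e ∈ ToricVariety.openOrbit Ξ → ∀ g : G, f (MulOpposite.op g • e) = f e * g := by
  have hp := hπ.isDiscretePrincipalBundle
  obtain ⟨e₀, he₀⟩ := hp.proj_surjective (ToricVariety.basePoint Ξ)
  -- The section over the open orbit swept out by `e₀`, evaluated at the base point of `e`.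
  let s : E → E := fun e => ToricVariety.toTorus (π e) • e₀
  have hs : ∀ e, π e ∈ ToricVariety.openOrbit Ξ → π (s e) = π e := fun e he => by
    rw [hπ.proj_torus_action, he₀, ToricVariety.toTorus_smul_basePoint he]
  have hsg : ∀ e (g : G), s (MulOpposite.op g • e) = s e := fun e g => by
    simp only [s, hπ.proj_right_action]
  have hsc : ContinuousOn s (π ⁻¹' ToricVariety.openOrbit Ξ) :=
    hπ.continuous_torus_smul.comp_continuousOn
      ((ToricVariety.continuousOn_toTorus.comp hπ.holomorphic_proj.continuous.continuousOn
        fun _ h => h).prodMk continuousOn_const)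
  -- The element `g` is the position of `e` relative to the section; away from the open orbit the
  -- value `1` is arbitrary.
  have hex : ∀ e, ∃ g : G, π e ∈ ToricVariety.openOrbit Ξ → e = MulOpposite.op g • s e := by
    intro e
    by_cases he : π e ∈ ToricVariety.openOrbit Ξ
    · obtain ⟨g, hg⟩ := hp.exists_smul_eq (hs e he)
      exact ⟨g, fun _ => hg⟩
    · exact ⟨1, fun h => absurd h he⟩
  choose f hf using hex
  refine ⟨f, fun e he => ?_, fun e he g => ?_⟩
  · obtain ⟨φ, hx, hφ⟩ := hp.locally_trivial (π e)
    have hsnd : ∀ e', π e' = π e → ContinuousAt (fun e => (φ e).2) e' := fun e' he' =>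
      continuousAt_snd.comp
        (φ.toOpenPartialHomeomorph.continuousAt (φ.mem_source.2 (he' ▸ hx)))
    -- Since `s e` and `e` lie in the same fibre, `f` is locally this quotient of fibre coordinates,
    -- which is visibly continuous.
    have hc : ContinuousWithinAt (fun e => (φ (s e)).2⁻¹ * (φ e).2)
        (π ⁻¹' ToricVariety.openOrbit Ξ) e :=
      (((hsnd (s e) (hs e he)).comp_continuousWithinAt (hsc e he)).inv).mul
        (hsnd e rfl).continuousWithinAt
    have hval : ∀ e', π e' ∈ ToricVariety.openOrbit Ξ → π e' ∈ φ.baseSet →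
        f e' = (φ (s e')).2⁻¹ * (φ e').2 := by
      intro e' he' hb
      have hse : s e' ∈ φ.source := φ.mem_source.2 (by rwa [hs e' he'])
      rw [eq_inv_mul_iff_mul_eq, ← hφ _ hse, ← hf e' he']
    refine hc.congr_of_eventuallyEq ?_ (hval e he hx)
    filter_upwards [self_mem_nhdsWithin, mem_nhdsWithin_of_mem_nhds
      (hπ.holomorphic_proj.continuous.continuousAt (φ.open_baseSet.mem_nhds hx))] with e' h1 h2
    exact hval e' h1 h2
  · have he' : π (MulOpposite.op g • e) ∈ ToricVariety.openOrbit Ξ := by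
      rwa [hπ.proj_right_action]
    -- As the action is free, it suffices to compare the results of acting on `s e`, which is also
    -- the section point for the translate of `e`.
    refine hp.op_smul_injective (s e) ?_
    change MulOpposite.op (f (MulOpposite.op g • e)) • s e = MulOpposite.op (f e * g) • s e
    have h := hf _ he'
    rw [hsg] at h
    rw [← h, MulOpposite.op_mul, mul_smul, ← hf e he]

/-- A continuous equivariant map to the discrete structure group trivializes the bundle
biholomorphically. -/
theorem exists_isPrincipalTrivialization
    (hπ : IsHolomorphicEquivariantPrincipalBundle n (Fin 0 → ℂ) G (Fin n → ℂ) C π)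
    {f : E → G} (hf : Continuous f) (heq : ∀ (e : E) (g : G), f (MulOpposite.op g • e) = f e * g) :
    ∃ Φ : Diffeomorph 𝓘(ℂ, C) (𝓘(ℂ, Fin n → ℂ).prod 𝓘(ℂ, Fin 0 → ℂ)) E (ToricVariety Ξ × G) ω,
      IsPrincipalTrivialization π Φ := by
  have hp := hπ.isDiscretePrincipalBundle
  have hinj : Function.Injective fun e => (π e, f e) := by
    intro e e' h
    obtain ⟨h1, h2⟩ := Prod.mk.inj h
    obtain ⟨g, rfl⟩ := hp.exists_smul_eq h1
    rw [heq, left_eq_mul] at h2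
    rw [h2, MulOpposite.op_one, one_smul]
  have hsurj : Function.Surjective fun e => (π e, f e) := by
    rintro ⟨x, g⟩
    obtain ⟨e, rfl⟩ := hp.proj_surjective x
    refine ⟨MulOpposite.op ((f e)⁻¹ * g) • e, Prod.ext (hπ.proj_right_action _ _) ?_⟩
    change f _ = g
    rw [heq, mul_inv_cancel_left]
  have hloc : ∀ e, ∀ᶠ e' in 𝓝 e, f e' = f e := fun e =>
    hf.continuousAt (IsOpen.mem_nhds (isOpen_discrete {f e}) rfl)
  let Φ : E ≃ ToricVariety Ξ × G := Equiv.ofBijective _ ⟨hinj, hsurj⟩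
  refine ⟨⟨Φ, ?_, ?_⟩, fun e => rfl, heq⟩
  · refine hπ.holomorphic_proj.prodMk fun e => ?_
    exact contMDiffAt_const.congr_of_eventuallyEq (hloc e)
  · intro p
    obtain ⟨e, rfl⟩ := Φ.surjective p
    obtain ⟨φ, hx, -, hφs, -⟩ := hπ.locally_trivial (π e)
    have he : e ∈ φ.source := φ.mem_source.2 hx
    -- Freezing the fibre coordinate at that of `e` projects onto the sheet of `φ` through `e`. Near
    -- `e` this sheet is also a level set of `f`, so the inverse of `Φ` agrees near `Φ e` with the
    -- holomorphic map `φ⁻¹ ∘ ψ`.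
    let ψ : ToricVariety Ξ × G → ToricVariety Ξ × G := fun q => (q.1, (φ e).2)
    have hψ : ContMDiff (𝓘(ℂ, Fin n → ℂ).prod 𝓘(ℂ, Fin 0 → ℂ))
        (𝓘(ℂ, Fin n → ℂ).prod 𝓘(ℂ, Fin 0 → ℂ)) ω ψ := contMDiff_fst.prodMk contMDiff_const
    have hψe : ψ (Φ e) ∈ φ.target := φ.mem_target.2 hx
    have hφψ : φ.toOpenPartialHomeomorph.symm (ψ (Φ e)) = e := φ.symm_apply_mk_proj he
    have hsm : ContMDiffAt (𝓘(ℂ, Fin n → ℂ).prod 𝓘(ℂ, Fin 0 → ℂ)) 𝓘(ℂ, C) ω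
        (φ.toOpenPartialHomeomorph.symm ∘ ψ) (Φ e) :=
      (hφs.contMDiffAt (φ.open_target.mem_nhds hψe)).comp _ hψ.contMDiffAt
    refine hsm.congr_of_eventuallyEq ?_
    have h1 : ∀ᶠ q in 𝓝 (Φ e), q.1 ∈ φ.baseSet :=
      continuousAt_fst (φ.open_baseSet.mem_nhds hx)
    have h2 : ∀ᶠ q in 𝓝 (Φ e), q.2 = f e :=
      (continuous_snd.tendsto (Φ e))
        (IsOpen.mem_nhds (isOpen_discrete {f e}) (Set.mem_singleton _))
    have h3 : ∀ᶠ q in 𝓝 (Φ e), f (φ.toOpenPartialHomeomorph.symm (ψ q)) = f e := by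
      have := hsm.continuousAt.tendsto
      rw [Function.comp_apply, hφψ] at this
      exact this.eventually (hloc e)
    filter_upwards [h1, h2, h3] with q h1 h2 h3
    change Φ.symm q = φ.toOpenPartialHomeomorph.symm (ψ q)
    rw [Equiv.symm_apply_eq]
    exact Prod.ext (φ.proj_symm_apply' h1).symm (h2.trans h3.symm)

/-- The torus is connected, so it acts trivially on the discrete fibre of any trivialization. -/
theorem torusActsTrivially
    (hπ : IsHolomorphicEquivariantPrincipalBundle n (Fin 0 → ℂ) G (Fin n → ℂ) C π)
    {Φ : Diffeomorph 𝓘(ℂ, C) (𝓘(ℂ, Fin n → ℂ).prod 𝓘(ℂ, Fin 0 → ℂ)) E (ToricVariety Ξ × G) ω}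
    (hΦ : IsPrincipalTrivialization π Φ) : TorusActsTrivially n Φ := by
  intro t e
  have hc : Continuous fun t : Torus n => (Φ (t • e)).2 :=
    continuous_snd.comp (Φ.continuous.comp
      (hπ.continuous_torus_smul.comp (continuous_id.prodMk continuous_const)))
  refine Prod.ext ?_ ?_
  · change (Φ (t • e)).1 = t • (Φ e).1
    rw [hΦ.1, hΦ.1, hπ.proj_torus_action]
  · have h := PreconnectedSpace.constant inferInstance hc (x := t) (y := 1)
    simpa using h

end IsHolomorphicEquivariantPrincipalBundle

end EquivariantBundle

theorem theorem4p2 {n : ℕ} (Ξ : NonsingularFan n)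
    {G : Type*} [Group G] [TopologicalSpace G] [DiscreteTopology G]
    {C : Type*} [NormedAddCommGroup C] [NormedSpace ℂ C]
    {E : Type*} [TopologicalSpace E] [ChartedSpace C E] [IsManifold 𝓘(ℂ, C) ω E]
    [MulAction (Torus n) E] [MulAction Gᵐᵒᵖ E]
    (π : E → ToricVariety Ξ)
    (hπ : IsHolomorphicEquivariantPrincipalBundle n (Fin 0 → ℂ) G (Fin n → ℂ) C π) :
    (∃ Φ : Diffeomorph 𝓘(ℂ, C) (𝓘(ℂ, Fin n → ℂ).prod 𝓘(ℂ, Fin 0 → ℂ)) E (ToricVariety Ξ × G) ω,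
      IsPrincipalTrivialization π Φ) ∧
    ∀ Φ : Diffeomorph 𝓘(ℂ, C) (𝓘(ℂ, Fin n → ℂ).prod 𝓘(ℂ, Fin 0 → ℂ)) E (ToricVariety Ξ × G) ω,
      IsPrincipalTrivialization π Φ → TorusActsTrivially n Φ := by
  obtain ⟨f₀, hf₀, heq₀⟩ := hπ.exists_continuousOn_openOrbit
  obtain ⟨f, hf, heq⟩ := hπ.isDiscretePrincipalBundle.exists_continuous_extension
    (fun x _ hs => ToricVariety.exists_nhds_isConnected_inter_openOrbit x hs) hf₀ heq₀
  exact ⟨hπ.exists_isPrincipalTrivialization hf heq, fun _ hΦ => hπ.torusActsTrivially hΦ⟩
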